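/- Let $\Omega\subset\mathbb R^2$ be a bounded open set with $0\in\Omega$. Let $b:\Omega\to\mathbb R^2$ belong to the weak Lebesgue space $L_{2,w}(\Omega)$, that is, $b$ is measurable and $\sup_{\lambda>0}\lambda\,|\{x\in\Omega:|b(x)|>\lambda\}|^{1/2}<\infty$, and assume that $\operatorname{div} b=0$ in $\mathcal D'(\Omega)$. For $\alpha\in\mathbb R$ put $b^{(\alpha)}(x):=b(x)-\alpha\,\frac{x}{|x|^2}$. Then $b^{(\alpha)}$ is locally integrable in $\Omega$ and $$\operatorname{div} b^{(\alpha)}=-2\pi\alpha\,\delta_0\quad\text{in }\mathcal D'(\Omega).$$ Moreover, let $p>2$ and let $v$ belong to $\overset{\circ}{W}{}^1_p(\Omega)$, the closure of $C_0^\infty(\Omega)$ in the norm of $W^1_p(\Omega)$. Then $v$ has a representative that is continuous on $\overline\Omega$ (its value at the origin is denoted by $v(0)$), the function $(b^{(\alpha)}\cdot\nabla v)\,v$ is integrable over $\Omega$, and $$\mathcal B_\alpha[v,v]:=\int_\Omega b^{(\alpha)}\cdot\nabla v\;v\,dx=\pi\alpha\,|v(0)|^2 .$$ -/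

import Mathlib

open MeasureTheory Set
open scoped ENNReal ContDiff

noncomputable section

/-- The Euclidean plane. -/
abbrev Plane : Type := EuclideanSpace ℝ (Fin 2)

/-- `φ ∈ C₀^∞(Ω)`: smooth, with compact support contained in `Ω`. -/
structure IsTestFunction (Ω : Set Plane) (φ : Plane → ℝ) : Prop where
  contDiff : ContDiff ℝ ∞ φ
  hasCompactSupport : HasCompactSupport φ
  tsupport_subset : tsupport φ ⊆ Ω

/-- The weak Lebesgue quasi-norm `sup_{t > 0} t |{x ∈ Ω : |b(x)| > t}|^{1/2}`. -/
def weakL2Norm (Ω : Set Plane) (b : Plane → Plane) : ℝ≥0∞ :=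
  ⨆ (t : ℝ) (_ : 0 < t), ENNReal.ofReal t * volume {x | x ∈ Ω ∧ t < ‖b x‖} ^ (1 / 2 : ℝ)

/-- `b ∈ L_{2,w}(Ω)`. -/
def MemWeakL2 (Ω : Set Plane) (b : Plane → Plane) : Prop :=
  AEStronglyMeasurable b (volume.restrict Ω) ∧ weakL2Norm Ω b < ⊤

/-- `div b = T` in `𝓓'(Ω)`, for a locally integrable field `b` on `Ω`; the distribution `T` is
given by its values on test functions. -/
def HasDistribDivergence (Ω : Set Plane) (b : Plane → Plane) (T : (Plane → ℝ) → ℝ) : Prop :=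
  LocallyIntegrableOn b Ω ∧
    ∀ φ : Plane → ℝ, IsTestFunction Ω φ → -∫ x in Ω, inner ℝ (b x) (gradient φ x) = T φ

/-- The field `G` is the weak gradient of `u` in `Ω`. -/
def HasWeakGradient (Ω : Set Plane) (u : Plane → ℝ) (G : Plane → Plane) : Prop :=
  LocallyIntegrableOn u Ω ∧ LocallyIntegrableOn G Ω ∧
    ∀ φ : Plane → ℝ, IsTestFunction Ω φ → ∀ i : Fin 2,
      ∫ x in Ω, u x * gradient φ x i = -∫ x in Ω, G x i * φ x

/-- `u` belongs to the closure of `C₀^∞(Ω)` in `W^1_p(Ω)`. -/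
def MemW1pZero (Ω : Set Plane) (p : ℝ≥0∞) (u : Plane → ℝ) : Prop :=
  ∃ G : Plane → Plane, HasWeakGradient Ω u G ∧
    MemLp u p (volume.restrict Ω) ∧ MemLp G p (volume.restrict Ω) ∧
    ∀ ε : ℝ≥0∞, 0 < ε → ∃ φ : Plane → ℝ, IsTestFunction Ω φ ∧
      eLpNorm (fun x => u x - φ x) p (volume.restrict Ω) ≤ ε ∧
      eLpNorm (fun x => G x - gradient φ x) p (volume.restrict Ω) ≤ ε

/-- The total drift `b^{(α)}(x) = b(x) - α x / |x|²`. -/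
def totalDrift (b : Plane → Plane) (α : ℝ) (x : Plane) : Plane :=
  b x - (α / ‖x‖ ^ 2) • x

/-- The integrand `(b^{(α)} · ∇u) η`, where `Du` stands for the (weak) gradient of `u`. -/
def driftIntegrand (b : Plane → Plane) (α : ℝ) (Du : Plane → Plane) (η : Plane → ℝ)
    (x : Plane) : ℝ :=
  inner ℝ (totalDrift b α x) (Du x) * η x

/-- The bilinear form `B_α[u, η] = ∫_Ω (b^{(α)} · ∇u) η dx`, with `Du` the gradient of `u`. -/
def driftForm (Ω : Set Plane) (b : Plane → Plane) (α : ℝ) (Du : Plane → Plane)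
    (η : Plane → ℝ) : ℝ :=
  ∫ x in Ω, driftIntegrand b α Du η x

end

/-!
The field `x / |x|²` has divergence `2π δ₀`: in polar coordinates `∇φ · x / |x|²` is, up to the
Jacobian, the derivative of `φ` along rays, so its integral is `-2π φ(0)`. Subtracting `α` times
this from a divergence-free `b` gives `div b^{(α)} = -2πα δ₀`, and since `φ ∇φ = ∇(φ²) / 2`, the
energy identity holds for test functions.

It extends to `W^1_p` with zero boundary values because every field of weak `L²` type on a set of
finite measure lies in `L^q` for all `q < 2`, in particular for the exponent conjugate to `p > 2`.
For `b` this makes the drift form continuous along convergent gradients and bounded functions. For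
the translates of `x / |x|²`, with a bound uniform in the translation, Hölder's inequality in
`-2π φ(y) = ∫ ∇φ · (x - y) / |x - y|² dx` bounds `sup |φ|` by the `L^p` norm of `∇φ`, so that
approximating test functions converge uniformly.
-/

open Filter Topology Metric Module
open scoped NNReal

section WeakLebesgue

variable {X E : Type*} [MeasurableSpace X] [NormedAddCommGroup E] {μ : Measure X}

theorem lintegral_rpow_enorm_eq_lintegral_meas_lt {f : X → E} (hf : AEStronglyMeasurable f μ)
    {q : ℝ} (hq : 0 < q) :
    ∫⁻ x, ‖f x‖ₑ ^ q ∂μ =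
      ENNReal.ofReal q * ∫⁻ t in Ioi 0, μ {x | t < ‖f x‖} * ENNReal.ofReal (t ^ (q - 1)) := by
  rw [← lintegral_rpow_eq_lintegral_meas_lt_mul μ (.of_forall fun x => norm_nonneg (f x))
    hf.norm.aemeasurable hq]
  refine lintegral_congr fun x => ?_
  rw [← ofReal_norm, ENNReal.ofReal_rpow_of_nonneg (norm_nonneg _) hq.le]

theorem lintegral_Ioc_zero_one_rpow {q : ℝ} (hq : 0 < q) :
    ∫⁻ t in Ioc (0 : ℝ) 1, ENNReal.ofReal (t ^ (q - 1)) = ENNReal.ofReal q⁻¹ := by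
  rw [← ofReal_integral_eq_lintegral_ofReal, ← intervalIntegral.integral_of_le zero_le_one,
    integral_rpow (.inl (by linarith))]
  · simp [hq.ne']
  · exact (intervalIntegral.intervalIntegrable_rpow' (by linarith)).1
  · filter_upwards [ae_restrict_mem measurableSet_Ioc] with t ht
    exact Real.rpow_nonneg ht.1.le _

theorem lintegral_Ioi_one_rpow {a : ℝ} (ha : a < -1) :
    ∫⁻ t in Ioi (1 : ℝ), ENNReal.ofReal (t ^ a) = ENNReal.ofReal (-(a + 1))⁻¹ := by
  rw [← ofReal_integral_eq_lintegral_ofReal (integrableOn_Ioi_rpow_of_lt ha zero_lt_one),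
    integral_Ioi_rpow_of_lt ha zero_lt_one, Real.one_rpow, neg_div, one_div, inv_neg]
  filter_upwards [ae_restrict_mem measurableSet_Ioi] with t ht
  exact Real.rpow_nonneg (zero_le_one.trans (le_of_lt ht)) _

/- In the layer-cake formula, levels below `1` are charged to the total mass and levels above `1`
to the weak bound. -/
theorem lintegral_rpow_enorm_le_of_meas_lt_le {f : X → E} (hf : AEStronglyMeasurable f μ)
    {q s : ℝ} (hq : 0 < q) (hqs : q < s) {K : ℝ≥0∞}
    (hK : ∀ t : ℝ, 1 < t → μ {x | t < ‖f x‖} ≤ K * ENNReal.ofReal (t ^ (-s))) :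
    ∫⁻ x, ‖f x‖ₑ ^ q ∂μ ≤ μ univ + K * ENNReal.ofReal (q / (s - q)) := by
  have low : ∫⁻ t in Ioc (0 : ℝ) 1, μ {x | t < ‖f x‖} * ENNReal.ofReal (t ^ (q - 1)) ≤
      μ univ * ENNReal.ofReal q⁻¹ := by
    rw [← lintegral_Ioc_zero_one_rpow hq, ← lintegral_const_mul _ (by fun_prop)]
    gcongr
    exact subset_univ _
  have high : ∫⁻ t in Ioi (1 : ℝ), μ {x | t < ‖f x‖} * ENNReal.ofReal (t ^ (q - 1)) ≤
      K * ENNReal.ofReal (s - q)⁻¹ := by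
    have hsq : (s - q)⁻¹ = (-(-s + (q - 1) + 1))⁻¹ := by ring_nf
    rw [hsq, ← lintegral_Ioi_one_rpow (by linarith), ← lintegral_const_mul _ (by fun_prop)]
    refine setLIntegral_mono' measurableSet_Ioi fun t ht => ?_
    have ht0 : 0 < t := zero_lt_one.trans ht
    rw [Real.rpow_add ht0, ENNReal.ofReal_mul (by positivity), ← mul_assoc]
    gcongr
    exact hK t ht
  calc ∫⁻ x, ‖f x‖ₑ ^ q ∂μ
      ≤ ENNReal.ofReal q * (μ univ * ENNReal.ofReal q⁻¹ + K * ENNReal.ofReal (s - q)⁻¹) := by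
        rw [lintegral_rpow_enorm_eq_lintegral_meas_lt hf hq,
          ← Ioc_union_Ioi_eq_Ioi (zero_le_one (α := ℝ))]
        gcongr
        exact (lintegral_union_le _ _ _).trans (add_le_add low high)
    _ = μ univ + K * ENNReal.ofReal (q / (s - q)) := by
        rw [mul_add, mul_left_comm, ← ENNReal.ofReal_mul hq.le, mul_inv_cancel₀ hq.ne',
          ENNReal.ofReal_one, mul_one, mul_left_comm, ← ENNReal.ofReal_mul hq.le, div_eq_mul_inv]

theorem eLpNorm_le_of_meas_lt_le {f : X → E} (hf : AEStronglyMeasurable f μ) {q : ℝ≥0∞} {s : ℝ}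
    (hq : q ≠ 0) (hqs : q < ENNReal.ofReal s) {K : ℝ≥0∞}
    (hK : ∀ t : ℝ, 1 < t → μ {x | t < ‖f x‖} ≤ K * ENNReal.ofReal (t ^ (-s))) :
    eLpNorm f q μ ≤
      (μ univ + K * ENNReal.ofReal (q.toReal / (s - q.toReal))) ^ (1 / q.toReal) := by
  have hqt : q ≠ ⊤ := hqs.ne_top
  rw [eLpNorm_eq_lintegral_rpow_enorm_toReal hq hqt]
  gcongr
  exact lintegral_rpow_enorm_le_of_meas_lt_le hf (ENNReal.toReal_pos hq hqt)
    ((ENNReal.lt_ofReal_iff_toReal_lt hqt).1 hqs) hK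

end WeakLebesgue

theorem MemWeakL2.measure_lt_norm_le {Ω : Set Plane} {b : Plane → Plane} (hb : MemWeakL2 Ω b)
    {t : ℝ} (ht : 0 < t) :
    volume.restrict Ω {x | t < ‖b x‖} ≤ weakL2Norm Ω b ^ 2 * ENNReal.ofReal (t ^ (-2 : ℝ)) := by
  have hmeas : NullMeasurableSet {x | t < ‖b x‖} (volume.restrict Ω) :=
    nullMeasurableSet_lt aemeasurable_const hb.1.norm.aemeasurable
  rw [Measure.restrict_apply₀ hmeas, ofPred_inter_eq_sep]
  set V := volume {x | x ∈ Ω ∧ t < ‖b x‖}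
  have hweak : ENNReal.ofReal t * V ^ (1 / 2 : ℝ) ≤ weakL2Norm Ω b := le_iSup₂_of_le t ht le_rfl
  have hsq : ENNReal.ofReal t ^ 2 * V ≤ weakL2Norm Ω b ^ 2 := by
    calc ENNReal.ofReal t ^ 2 * V = (ENNReal.ofReal t * V ^ (1 / 2 : ℝ)) ^ 2 := by
          rw [mul_pow, ← ENNReal.rpow_mul_natCast]
          norm_num
      _ ≤ weakL2Norm Ω b ^ 2 := by gcongr
  have hinv : ENNReal.ofReal (t ^ (-2 : ℝ)) = (ENNReal.ofReal t ^ 2)⁻¹ := by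
    rw [← ENNReal.ofReal_pow ht.le, ← ENNReal.ofReal_inv_of_pos (by positivity),
      Real.rpow_neg ht.le, Real.rpow_two]
  rw [hinv, ← div_eq_mul_inv, ENNReal.le_div_iff_mul_le (by simp [ht]) (by simp), mul_comm]
  exact hsq

theorem MemWeakL2.memLp {Ω : Set Plane} (hvol : volume Ω ≠ ⊤) {b : Plane → Plane}
    (hb : MemWeakL2 Ω b) {q : ℝ≥0∞} (hq0 : q ≠ 0) (hq2 : q < 2) :
    MemLp b q (volume.restrict Ω) := by
  refine ⟨hb.1, (eLpNorm_le_of_meas_lt_le hb.1 hq0 (by simpa using hq2) fun t ht =>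
    hb.measure_lt_norm_le (zero_lt_one.trans ht)).trans_lt ?_⟩
  have hweak : weakL2Norm Ω b ≠ ⊤ := hb.2.ne
  rw [Measure.restrict_apply_univ]
  exact (ENNReal.rpow_ne_top_of_nonneg (by positivity) (by finiteness)).lt_top

theorem integrableOn_bilin_of_hasCompactSupport {X E₁ E₂ E₃ : Type*} [TopologicalSpace X]
    [MeasurableSpace X] [OpensMeasurableSpace X] [NormedAddCommGroup E₁] [NormedSpace ℝ E₁]
    [NormedAddCommGroup E₂] [NormedSpace ℝ E₂] [NormedAddCommGroup E₃] [NormedSpace ℝ E₃]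
    [SecondCountableTopologyEither X E₂] {μ : Measure X} (B : E₁ →L[ℝ] E₂ →L[ℝ] E₃) {Ω : Set X}
    (hΩ : MeasurableSet Ω) {F : X → E₁} {g : X → E₂} (hF : LocallyIntegrableOn F Ω μ)
    (hg : Continuous g) (hc : HasCompactSupport g) (hgΩ : tsupport g ⊆ Ω) :
    IntegrableOn (fun x => B (F x) (g x)) Ω μ := by
  obtain ⟨C, hC⟩ := hg.bounded_above_of_compact_support hc
  have hsupp : IntegrableOn (fun x => B (F x) (g x)) (tsupport g) μ :=
    B.integrable_of_bilin_of_bdd_right C (hF.integrableOn_compact_subset hgΩ hc)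
      hg.aestronglyMeasurable (.of_forall hC)
  refine hsupp.of_forall_sdiff_eq_zero hΩ fun x hx => ?_
  rw [image_eq_zero_of_notMem_tsupport hx.2, map_zero]

theorem integral_Ioi_fderiv_smul {E : Type*} [NormedAddCommGroup E] [NormedSpace ℝ E] {φ : E → ℝ}
    (hφ : ContDiff ℝ 1 φ) (hc : HasCompactSupport φ) {θ : E} (hθ : θ ≠ 0) :
    ∫ r in Ioi (0 : ℝ), fderiv ℝ φ (r • θ) θ = -φ 0 := by
  have hray : Topology.IsClosedEmbedding fun r : ℝ => r • θ := isClosedEmbedding_smul_left hθ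
  have hderiv : deriv (fun r : ℝ => φ (r • θ)) = fun r => fderiv ℝ φ (r • θ) θ := by
    funext r
    have hline : HasDerivAt (fun r : ℝ => r • θ) θ r := by
      simpa using (hasDerivAt_id r).smul_const θ
    exact ((hφ.differentiable one_ne_zero _).hasFDerivAt.comp_hasDerivAt r hline).deriv
  have := (hc.comp_isClosedEmbedding hray).integral_Ioi_deriv_eq
    (hφ.comp (contDiff_id.smul contDiff_const)) 0
  simpa [Function.comp_def, hderiv] using this

section PolarCoordinates

variable {E F : Type*} [NormedAddCommGroup E] [NormedSpace ℝ E] [FiniteDimensional ℝ E]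
  [Nontrivial E] [MeasurableSpace E] [BorelSpace E] [NormedAddCommGroup F] [NormedSpace ℝ F]
  (μ : Measure E) [μ.IsAddHaarMeasure]

theorem integral_volumeIoiPow (n : ℕ) (g : ℝ → F) :
    ∫ r : Ioi (0 : ℝ), g r ∂Measure.volumeIoiPow n = ∫ r in Ioi (0 : ℝ), r ^ n • g r := by
  simp only [Measure.volumeIoiPow, ENNReal.ofReal]
  rw [integral_withDensity_eq_integral_smul (by fun_prop),
    integral_subtype_comap measurableSet_Ioi fun r => Real.toNNReal (r ^ n) • g r]
  refine setIntegral_congr_fun measurableSet_Ioi fun r hr => ?_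
  rw [NNReal.smul_def, Real.coe_toNNReal _ (pow_nonneg (le_of_lt hr) _)]

theorem integral_eq_integral_toSphere {f : E → F} (hf : Integrable f μ) :
    ∫ x, f x ∂μ = ∫ θ : sphere (0 : E) 1, (∫ r in Ioi (0 : ℝ),
      r ^ (finrank ℝ E - 1) • f (r • (θ : E))) ∂μ.toSphere := by
  let g : sphere (0 : E) 1 × Ioi (0 : ℝ) → F := fun z => f ((z.2 : ℝ) • (z.1 : E))
  have hg : ∀ x : ({0}ᶜ : Set E), g (homeomorphUnitSphereProd E x) = f x := by
    intro x
    simp only [g, homeomorphUnitSphereProd_apply_fst_coe, homeomorphUnitSphereProd_apply_snd_coe,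
      smul_inv_smul₀ (norm_ne_zero_iff.2 x.2)]
  have hpolar := μ.measurePreserving_homeomorphUnitSphereProd
  have hemb := (homeomorphUnitSphereProd E).measurableEmbedding
  have hgint : Integrable g (μ.toSphere.prod (.volumeIoiPow (finrank ℝ E - 1))) := by
    rw [← hpolar.integrable_comp_emb hemb, show g ∘ homeomorphUnitSphereProd E = f ∘ (↑) from
      funext hg, ← integrableOn_iff_comap_subtypeVal (measurableSet_singleton _).compl]
    exact hf.integrableOn
  calc ∫ x, f x ∂μ = ∫ x : ({0}ᶜ : Set E), f x ∂μ.comap (↑) := by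
        rw [integral_subtype_comap (measurableSet_singleton _).compl, restrict_compl_singleton]
    _ = ∫ z, g z ∂μ.toSphere.prod (.volumeIoiPow (finrank ℝ E - 1)) := by
        rw [← hpolar.integral_comp hemb]
        simp only [hg]
    _ = ∫ θ : sphere (0 : E) 1, (∫ r in Ioi (0 : ℝ),
          r ^ (finrank ℝ E - 1) • f (r • (θ : E))) ∂μ.toSphere := by
        rw [integral_prod _ hgint]
        exact integral_congr_ae (.of_forall fun θ => integral_volumeIoiPow _ fun r => f (r • θ))

theorem locallyIntegrable_norm_pow_inv :
    LocallyIntegrable (fun x : E => (‖x‖ ^ (finrank ℝ E - 1))⁻¹) μ := by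
  rw [locallyIntegrable_iff]
  intro k hk
  obtain ⟨R, hR⟩ := hk.isBounded.subset_ball 0
  refine IntegrableOn.mono_set ?_ hR
  refine (integrableOn_fun_norm_addHaar μ (f := fun r => (r ^ (finrank ℝ E - 1))⁻¹)).2 ?_
  refine (integrableOn_const (C := (1 : ℝ)) measure_Ioo_lt_top.ne).congr_fun (fun r hr => ?_)
    measurableSet_Ioo
  have : r ≠ 0 := hr.1.ne'
  simp [this]

end PolarCoordinates

/-- The field `x / ‖x‖ⁿ` on a space of dimension `n`: up to a constant factor, the gradient of the
fundamental solution of the Laplacian. -/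
noncomputable def radialField {E : Type*} [NormedAddCommGroup E] [NormedSpace ℝ E] (x : E) : E :=
  (‖x‖ ^ finrank ℝ E)⁻¹ • x

theorem norm_radialField_le {E : Type*} [NormedAddCommGroup E] [NormedSpace ℝ E]
    [FiniteDimensional ℝ E] [Nontrivial E] (x : E) :
    ‖radialField x‖ ≤ (‖x‖ ^ (finrank ℝ E - 1))⁻¹ := by
  rcases eq_or_ne x 0 with rfl | hx
  · rw [radialField, smul_zero, norm_zero]
    positivity
  · have hx' : ‖x‖ ≠ 0 := norm_ne_zero_iff.2 hx
    rw [radialField, norm_smul, norm_inv, norm_pow, norm_norm,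
      ← pow_sub_one_mul finrank_pos.ne' ‖x‖, mul_inv, inv_mul_cancel_right₀ hx']

section RadialField

variable {E : Type*} [NormedAddCommGroup E] [NormedSpace ℝ E] [FiniteDimensional ℝ E]
  [MeasurableSpace E] [BorelSpace E]

theorem measurable_radialField : Measurable (radialField : E → E) := by
  unfold radialField
  fun_prop

variable [Nontrivial E] (μ : Measure E) [μ.IsAddHaarMeasure]

theorem locallyIntegrable_radialField : LocallyIntegrable (radialField : E → E) μ :=
  (locallyIntegrable_norm_pow_inv μ).mono measurable_radialField.aestronglyMeasurable
    (.of_forall fun x => (norm_radialField_le x).trans (le_abs_self _))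

theorem integral_fderiv_radialField {φ : E → ℝ} (hφ : ContDiff ℝ 1 φ)
    (hc : HasCompactSupport φ) :
    ∫ x, fderiv ℝ φ x (radialField x) ∂μ = -(finrank ℝ E * μ.real (ball 0 1)) * φ 0 := by
  have hint : Integrable (fun x => fderiv ℝ φ x (radialField x)) μ := by
    rw [← integrableOn_univ]
    exact integrableOn_bilin_of_hasCompactSupport (.flip (.id ℝ (E →L[ℝ] ℝ))) .univ
      ((locallyIntegrable_radialField μ).locallyIntegrableOn univ)
      (hφ.continuous_fderiv one_ne_zero) (hc.fderiv ℝ) (subset_univ _)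
  have hradial : ∀ θ : sphere (0 : E) 1, ∫ r in Ioi (0 : ℝ), r ^ (finrank ℝ E - 1) •
      fderiv ℝ φ (r • (θ : E)) (radialField (r • (θ : E))) = -φ 0 := by
    intro θ
    rw [← integral_Ioi_fderiv_smul hφ hc (ne_zero_of_mem_unit_sphere θ)]
    refine setIntegral_congr_fun measurableSet_Ioi fun r (hr : 0 < r) => ?_
    simp only [radialField, norm_smul, norm_eq_of_mem_sphere, mul_one, Real.norm_of_nonneg hr.le,
      map_smul, smul_eq_mul, ← pow_sub_one_mul (finrank_pos (R := ℝ) (M := E)).ne' r]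
    field_simp
  calc ∫ x, fderiv ℝ φ x (radialField x) ∂μ = ∫ _ : sphere (0 : E) 1, -φ 0 ∂μ.toSphere := by
        rw [integral_eq_integral_toSphere μ hint]
        simp only [hradial]
    _ = -(finrank ℝ E * μ.real (ball 0 1)) * φ 0 := by
        rw [integral_const, μ.toSphere_real_apply_univ, smul_eq_mul]
        ring

theorem integral_fderiv_radialField_sub {φ : E → ℝ} (hφ : ContDiff ℝ 1 φ)
    (hc : HasCompactSupport φ) (y : E) :
    ∫ x, fderiv ℝ φ x (radialField (x - y)) ∂μ =
      -(finrank ℝ E * μ.real (ball 0 1)) * φ y := by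
  have hshift := integral_fderiv_radialField μ (φ := fun x => φ (x + y))
    (hφ.comp (contDiff_id.add contDiff_const)) (hc.comp_homeomorph (Homeomorph.addRight y))
  simp only [fderiv_comp_add_right, zero_add] at hshift
  rw [← hshift, ← integral_add_right_eq_self _ y]
  simp only [add_sub_cancel_right]

end RadialField

theorem totalDrift_eq (b : Plane → Plane) (α : ℝ) : totalDrift b α = b - α • radialField := by
  funext x
  simp [totalDrift, radialField, smul_smul, div_eq_mul_inv]

theorem volume_lt_norm_radialField_sub_le (y : Plane) {t : ℝ} (ht : 0 < t) :
    volume {x | t < ‖radialField (x - y)‖} ≤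
      ENNReal.ofReal Real.pi * ENNReal.ofReal (t ^ (-2 : ℝ)) := by
  have hball : {x | t < ‖radialField (x - y)‖} ⊆ ball y t⁻¹ := by
    intro x (hx : t < ‖radialField (x - y)‖)
    have hinv : t < ‖x - y‖⁻¹ := hx.trans_le (by simpa using norm_radialField_le (x - y))
    rw [mem_ball_iff_norm]
    exact (lt_inv_comm₀ ht (inv_pos.1 (ht.trans hinv))).1 hinv
  refine (measure_mono hball).trans_eq ?_
  rw [EuclideanSpace.volume_ball_fin_two, mul_comm, ← ENNReal.ofReal_pow (by positivity), inv_pow,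
    Real.rpow_neg ht.le, Real.rpow_two]

theorem eLpNorm_radialField_sub_le (Ω : Set Plane) {q : ℝ≥0∞} (hq0 : q ≠ 0) (hq2 : q < 2)
    (y : Plane) :
    eLpNorm (fun x => radialField (x - y)) q (volume.restrict Ω) ≤
      (volume Ω + ENNReal.ofReal Real.pi * ENNReal.ofReal (q.toReal / (2 - q.toReal))) ^
        (1 / q.toReal) := by
  rw [← Measure.restrict_apply_univ Ω]
  refine eLpNorm_le_of_meas_lt_le
    (measurable_radialField.comp (measurable_id.sub_const y)).aestronglyMeasurable hq0
    (by simpa using hq2) fun t ht => ?_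
  exact (Measure.restrict_apply_le _ _).trans
    (volume_lt_norm_radialField_sub_le y (zero_lt_one.trans ht))

theorem exists_eLpNorm_radialField_sub_le {Ω : Set Plane} (hvol : volume Ω ≠ ⊤) {q : ℝ≥0∞}
    (hq0 : q ≠ 0) (hq2 : q < 2) :
    ∃ C : ℝ≥0, ∀ y : Plane,
      eLpNorm (fun x => radialField (x - y)) q (volume.restrict Ω) ≤ C := by
  refine ⟨ENNReal.toNNReal _, fun y => (eLpNorm_radialField_sub_le Ω hq0 hq2 y).trans_eq
    (ENNReal.coe_toNNReal ?_).symm⟩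
  exact ENNReal.rpow_ne_top_of_nonneg (by positivity) (by finiteness)

theorem inner_gradient_eq_fderiv {H : Type*} [NormedAddCommGroup H] [InnerProductSpace ℝ H]
    [CompleteSpace H] (φ : H → ℝ) (x v : H) : inner ℝ v (gradient φ x) = fderiv ℝ φ x v := by
  rw [real_inner_comm, gradient, InnerProductSpace.toDual_symm_apply]

theorem continuous_gradient {H : Type*} [NormedAddCommGroup H] [InnerProductSpace ℝ H]
    [CompleteSpace H] {φ : H → ℝ} (hφ : ContDiff ℝ 1 φ) : Continuous (gradient φ) :=
  (InnerProductSpace.toDual ℝ H).symm.continuous.comp (hφ.continuous_fderiv one_ne_zero)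

theorem tsupport_gradient_subset {H : Type*} [NormedAddCommGroup H] [InnerProductSpace ℝ H]
    [CompleteSpace H] (φ : H → ℝ) : tsupport (gradient φ) ⊆ tsupport φ :=
  (closure_mono (Function.support_comp_subset (map_zero _) (fderiv ℝ φ))).trans
    (tsupport_fderiv_subset ℝ)

theorem gradient_mul_self {H : Type*} [NormedAddCommGroup H] [InnerProductSpace ℝ H]
    [CompleteSpace H] {φ : H → ℝ} {x : H} (hφ : DifferentiableAt ℝ φ x) :
    gradient (φ * φ) x = (2 : ℝ) • φ x • gradient φ x := by
  rw [gradient, fderiv_mul hφ hφ, ← two_smul ℝ, map_smul, map_smul, gradient]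

theorem integral_inner_radialField_sub_gradient {φ : Plane → ℝ} (hφ : ContDiff ℝ 1 φ)
    (hc : HasCompactSupport φ) (y : Plane) :
    ∫ x, inner ℝ (radialField (x - y)) (gradient φ x) = -(2 * Real.pi) * φ y := by
  simp only [inner_gradient_eq_fderiv, integral_fderiv_radialField_sub volume hφ hc, Measure.real,
    EuclideanSpace.volume_ball_fin_two, finrank_euclideanSpace_fin]
  simp [Real.pi_pos.le]

namespace IsTestFunction

variable {Ω : Set Plane} {φ ψ : Plane → ℝ}

theorem contDiff_one (hφ : IsTestFunction Ω φ) : ContDiff ℝ 1 φ :=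
  hφ.contDiff.of_le (by norm_cast)

theorem differentiable (hφ : IsTestFunction Ω φ) : Differentiable ℝ φ :=
  hφ.contDiff_one.differentiable one_ne_zero

theorem continuous (hφ : IsTestFunction Ω φ) : Continuous φ :=
  hφ.contDiff.continuous

theorem continuous_gradient (hφ : IsTestFunction Ω φ) : Continuous (gradient φ) :=
  _root_.continuous_gradient hφ.contDiff_one

theorem tsupport_gradient_subset (hφ : IsTestFunction Ω φ) : tsupport (gradient φ) ⊆ Ω :=
  (_root_.tsupport_gradient_subset φ).trans hφ.tsupport_subset

theorem hasCompactSupport_gradient (hφ : IsTestFunction Ω φ) : HasCompactSupport (gradient φ) :=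
  hφ.hasCompactSupport.mono' ((subset_tsupport _).trans (_root_.tsupport_gradient_subset φ))

theorem mul_self (hφ : IsTestFunction Ω φ) : IsTestFunction Ω (φ * φ) where
  contDiff := hφ.contDiff.mul hφ.contDiff
  hasCompactSupport := hφ.hasCompactSupport.mul_left
  tsupport_subset := tsupport_mul_subset_left.trans hφ.tsupport_subset

theorem sub (hφ : IsTestFunction Ω φ) (hψ : IsTestFunction Ω ψ) : IsTestFunction Ω (φ - ψ) where
  contDiff := hφ.contDiff.sub hψ.contDiff
  hasCompactSupport := hφ.hasCompactSupport.sub hψ.hasCompactSupport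
  tsupport_subset := (tsupport_sub φ ψ).trans (union_subset hφ.tsupport_subset hψ.tsupport_subset)

theorem gradient_sub (hφ : IsTestFunction Ω φ) (hψ : IsTestFunction Ω ψ) :
    gradient (φ - ψ) = gradient φ - gradient ψ := by
  funext x
  rw [gradient, fderiv_sub (hφ.differentiable x) (hψ.differentiable x), map_sub, Pi.sub_apply,
    gradient, gradient]

theorem memLp (hφ : IsTestFunction Ω φ) (p : ℝ≥0∞) : MemLp φ p (volume.restrict Ω) :=
  (hφ.continuous.memLp_of_hasCompactSupport hφ.hasCompactSupport).restrict Ω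

theorem memLp_gradient (hφ : IsTestFunction Ω φ) (p : ℝ≥0∞) :
    MemLp (gradient φ) p (volume.restrict Ω) :=
  (hφ.continuous_gradient.memLp_of_hasCompactSupport hφ.hasCompactSupport_gradient).restrict Ω

theorem setIntegral_inner_radialField_sub (hφ : IsTestFunction Ω φ) (y : Plane) :
    ∫ x in Ω, inner ℝ (radialField (x - y)) (gradient φ x) = -(2 * Real.pi) * φ y := by
  rw [← integral_inner_radialField_sub_gradient hφ.contDiff_one hφ.hasCompactSupport y]
  refine setIntegral_eq_integral_of_forall_compl_eq_zero fun x hx => ?_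
  rw [image_eq_zero_of_notMem_tsupport fun h => hx (hφ.tsupport_gradient_subset h),
    inner_zero_right]

theorem integrableOn_inner_gradient (hφ : IsTestFunction Ω φ) (hΩ : MeasurableSet Ω)
    {F : Plane → Plane} (hF : LocallyIntegrableOn F Ω) :
    IntegrableOn (fun x => inner ℝ (F x) (gradient φ x)) Ω :=
  integrableOn_bilin_of_hasCompactSupport (innerSL ℝ) hΩ hF hφ.continuous_gradient
    hφ.hasCompactSupport_gradient hφ.tsupport_gradient_subset

theorem integrableOn_mul (hφ : IsTestFunction Ω φ) (hΩ : MeasurableSet Ω) {f : Plane → ℝ}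
    (hf : LocallyIntegrableOn f Ω) : IntegrableOn (fun x => f x * φ x) Ω :=
  integrableOn_bilin_of_hasCompactSupport (.mul ℝ ℝ) hΩ hf hφ.continuous
    hφ.hasCompactSupport hφ.tsupport_subset

end IsTestFunction

namespace HasDistribDivergence

variable {Ω : Set Plane} {F G : Plane → Plane} {S T : (Plane → ℝ) → ℝ}

theorem sub (hΩ : MeasurableSet Ω) (hF : HasDistribDivergence Ω F S)
    (hG : HasDistribDivergence Ω G T) : HasDistribDivergence Ω (F - G) (S - T) := by
  refine ⟨hF.1.sub hG.1, fun φ hφ => ?_⟩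
  simp only [Pi.sub_apply, inner_sub_left]
  rw [integral_sub (hφ.integrableOn_inner_gradient hΩ hF.1)
    (hφ.integrableOn_inner_gradient hΩ hG.1), ← hF.2 φ hφ, ← hG.2 φ hφ]
  ring

theorem const_smul (c : ℝ) (hF : HasDistribDivergence Ω F S) :
    HasDistribDivergence Ω (c • F) (c • S) := by
  refine ⟨hF.1.smul c, fun φ hφ => ?_⟩
  simp only [Pi.smul_apply, real_inner_smul_left, integral_const_mul, smul_eq_mul, ← hF.2 φ hφ]
  ring

theorem integral_inner_smul_gradient (hF : HasDistribDivergence Ω F T) {φ : Plane → ℝ}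
    (hφ : IsTestFunction Ω φ) :
    ∫ x in Ω, inner ℝ (F x) (φ x • gradient φ x) = -(T (φ * φ) / 2) := by
  rw [← hF.2 _ hφ.mul_self]
  simp only [gradient_mul_self (hφ.differentiable _), real_inner_smul_right, integral_const_mul]
  ring

end HasDistribDivergence

theorem hasDistribDivergence_radialField (Ω : Set Plane) :
    HasDistribDivergence Ω radialField fun φ => 2 * Real.pi * φ 0 := by
  refine ⟨(locallyIntegrable_radialField volume).locallyIntegrableOn Ω, fun φ hφ => ?_⟩
  have hflux := hφ.setIntegral_inner_radialField_sub 0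
  simp only [sub_zero] at hflux
  rw [hflux]
  ring

theorem hasDistribDivergence_totalDrift {Ω : Set Plane} (hΩ : MeasurableSet Ω)
    {b : Plane → Plane} (hdiv : HasDistribDivergence Ω b fun _ => 0) (α : ℝ) :
    HasDistribDivergence Ω (totalDrift b α) fun φ => -(2 * Real.pi * α) * φ 0 := by
  rw [totalDrift_eq]
  convert hdiv.sub hΩ ((hasDistribDivergence_radialField Ω).const_smul α) using 1
  funext φ
  simp only [Pi.sub_apply, Pi.smul_apply, smul_eq_mul]
  ring

theorem lt_two_of_holderConjugate {p q : ℝ≥0∞} [ENNReal.HolderConjugate q p] (hp : 2 < p) :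
    q < 2 := by
  have hsum : q⁻¹ + p⁻¹ = 2⁻¹ + 2⁻¹ := by
    rw [ENNReal.HolderConjugate.inv_add_inv_eq_one, ENNReal.inv_two_add_inv_two]
  by_contra! hle
  have hlt : q⁻¹ + p⁻¹ < 2⁻¹ + 2⁻¹ :=
    ENNReal.add_lt_add_of_le_of_lt (by finiteness) (ENNReal.inv_le_inv.2 hle)
      (ENNReal.inv_lt_inv.2 hp)
  exact hlt.ne hsum

theorem enorm_setIntegral_inner_le {X H : Type*} [MeasurableSpace X] [NormedAddCommGroup H]
    [InnerProductSpace ℝ H] {μ : Measure X} {p q : ℝ≥0∞} [ENNReal.HolderConjugate q p]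
    {f g : X → H} (hf : AEStronglyMeasurable f μ) (hg : AEStronglyMeasurable g μ) :
    ‖∫ x, inner ℝ (f x) (g x) ∂μ‖ₑ ≤ eLpNorm f q μ * eLpNorm g p μ := by
  calc ‖∫ x, inner ℝ (f x) (g x) ∂μ‖ₑ ≤ eLpNorm (fun x => inner ℝ (f x) (g x)) 1 μ := by
        rw [eLpNorm_one_eq_lintegral_enorm]
        exact enorm_integral_le_lintegral_enorm _
    _ ≤ eLpNorm f q μ * eLpNorm g p μ := by
        simpa using eLpNorm_le_eLpNorm_mul_eLpNorm_of_nnnorm (p := q) (q := p) (r := 1) hf hg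
          (fun a b => inner ℝ a b) 1
          (.of_forall fun x => by simpa using nnnorm_inner_le_nnnorm (f x) (g x))

theorem exists_enorm_le_eLpNorm_gradient {Ω : Set Plane} (hvol : volume Ω ≠ ⊤) {p : ℝ≥0∞}
    (hp : 2 < p) :
    ∃ C : ℝ≥0, ∀ φ, IsTestFunction Ω φ → ∀ y,
      ‖φ y‖ₑ ≤ C * eLpNorm (gradient φ) p (volume.restrict Ω) := by
  have hconj : ENNReal.HolderConjugate p.conjExponent p :=
    (ENNReal.HolderConjugate.conjExponent (one_le_two.trans hp.le)).symm
  obtain ⟨C, hC⟩ := exists_eLpNorm_radialField_sub_le hvol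
    (ENNReal.HolderConjugate.ne_zero p.conjExponent p) (lt_two_of_holderConjugate hp)
  refine ⟨C, fun φ hφ y => ?_⟩
  calc ‖φ y‖ₑ ≤ ‖-(2 * Real.pi) * φ y‖ₑ := by
        rw [enorm_mul, enorm_neg]
        refine le_mul_of_one_le_left zero_le ?_
        rw [Real.enorm_of_nonneg (by positivity), ENNReal.one_le_ofReal]
        linarith [Real.pi_gt_three]
    _ = ‖∫ x in Ω, inner ℝ (radialField (x - y)) (gradient φ x)‖ₑ := by
        rw [hφ.setIntegral_inner_radialField_sub]
    _ ≤ eLpNorm (fun x => radialField (x - y)) p.conjExponent (volume.restrict Ω) *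
          eLpNorm (gradient φ) p (volume.restrict Ω) :=
        enorm_setIntegral_inner_le
          (measurable_radialField.comp (measurable_id.sub_const y)).aestronglyMeasurable
          (hφ.memLp_gradient p).1
    _ ≤ C * eLpNorm (gradient φ) p (volume.restrict Ω) := by
        gcongr
        exact hC y

theorem HasWeakGradient.ae_eq {Ω : Set Plane} (hΩ : IsOpen Ω) {u : Plane → ℝ}
    {G H : Plane → Plane} (hG : HasWeakGradient Ω u G) (hH : HasWeakGradient Ω u H) :
    G =ᵐ[volume.restrict Ω] H := by
  have hcoord : ∀ i : Fin 2, ∀ {F : Plane → Plane}, LocallyIntegrableOn F Ω →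
      LocallyIntegrableOn (fun x => F x i) Ω := fun i F hF x hx =>
    (hF x hx).imp fun _ hs => ⟨hs.1, (EuclideanSpace.proj i : Plane →L[ℝ] ℝ).integrable_comp hs.2⟩
  have hzero : ∀ i : Fin 2, ∀ᵐ x, x ∈ Ω → G x i - H x i = 0 := by
    intro i
    have hGi := hcoord i hG.2.1
    have hHi := hcoord i hH.2.1
    refine hΩ.ae_eq_zero_of_integral_contDiff_smul_eq_zero (hGi.sub hHi) fun φ hφ hc hsub => ?_
    have htest : IsTestFunction Ω φ := ⟨hφ, hc, hsub⟩
    calc ∫ x, φ x • (G x i - H x i) = ∫ x in Ω, φ x • (G x i - H x i) := by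
          refine (setIntegral_eq_integral_of_forall_compl_eq_zero fun x hx => ?_).symm
          rw [image_eq_zero_of_notMem_tsupport fun h => hx (hsub h), zero_smul]
      _ = (∫ x in Ω, G x i * φ x) - ∫ x in Ω, H x i * φ x := by
          rw [← integral_sub (htest.integrableOn_mul hΩ.measurableSet hGi)
            (htest.integrableOn_mul hΩ.measurableSet hHi)]
          simp only [smul_eq_mul, mul_comm (φ _), sub_mul]
      _ = 0 := by
          rw [sub_eq_zero, ← neg_inj, ← hG.2.2 φ htest i, hH.2.2 φ htest i]
  rw [Filter.EventuallyEq, ae_restrict_iff' hΩ.measurableSet]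
  filter_upwards [ae_all_iff.2 hzero] with x hx hxΩ
  ext i
  exact sub_eq_zero.1 (hx i hxΩ)

theorem exists_tendstoUniformly_of_edist_le {X E : Type*} [PseudoEMetricSpace E] [CompleteSpace E]
    {f : ℕ → X → E} {δ : ℕ → ℝ≥0∞} (hδ : Tendsto δ atTop (𝓝 0)) {C : ℝ≥0}
    (hf : ∀ m n x, edist (f m x) (f n x) ≤ C * (δ m + δ n)) :
    ∃ w, TendstoUniformly f w atTop := by
  have hbound : Tendsto (fun k : ℕ × ℕ => C * (δ k.1 + δ k.2)) (atTop ×ˢ atTop) (𝓝 0) := by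
    simpa using ENNReal.Tendsto.const_mul
      ((hδ.comp tendsto_fst).add (hδ.comp tendsto_snd)) (.inr ENNReal.coe_ne_top)
  have hcauchy : UniformCauchySeqOn f atTop univ := by
    intro U hU
    obtain ⟨ε, hε, hεU⟩ := mem_uniformity_edist.1 hU
    filter_upwards [hbound.eventually_lt_const hε] with k hk x _
    exact hεU ((hf k.1 k.2 x).trans_lt hk)
  choose w hw using fun x => cauchySeq_tendsto_of_complete (hcauchy.cauchySeq (mem_univ x))
  exact ⟨w, tendstoUniformlyOn_univ.1 (hcauchy.tendstoUniformlyOn_of_tendsto fun x _ => hw x)⟩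

theorem tendsto_eLpNorm_top_of_tendstoUniformly {X E ι : Type*} [MeasurableSpace X]
    [NormedAddCommGroup E] (μ : Measure X) {l : Filter ι} {f : ι → X → E} {w : X → E}
    (h : TendstoUniformly f w l) : Tendsto (fun n => eLpNorm (f n - w) ⊤ μ) l (𝓝 0) := by
  refine ENNReal.tendsto_nhds_zero.2 fun ε hε => ?_
  filter_upwards [EMetric.tendstoUniformly_iff.1 h ε hε] with n hn
  rw [eLpNorm_exponent_top]
  refine eLpNormEssSup_le_of_ae_enorm_bound (.of_forall fun x => ?_)
  rw [Pi.sub_apply, ← edist_eq_enorm_sub, edist_comm]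
  exact (hn x).le

theorem tendsto_integral_inner {X H ι : Type*} [MeasurableSpace X] [NormedAddCommGroup H]
    [InnerProductSpace ℝ H] {μ : Measure X} {p q : ℝ≥0∞} [ENNReal.HolderConjugate q p]
    {l : Filter ι} {F : X → H} {g : ι → X → H} {G : X → H} (hF : MemLp F q μ)
    (hg : ∀ n, MemLp (g n) p μ) (hG : MemLp G p μ)
    (hgG : Tendsto (fun n => eLpNorm (g n - G) p μ) l (𝓝 0)) :
    Tendsto (fun n => ∫ x, inner ℝ (F x) (g n x) ∂μ) l (𝓝 (∫ x, inner ℝ (F x) (G x) ∂μ)) := by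
  have : Fact (1 ≤ p) := ⟨ENNReal.HolderConjugate.one_le p q⟩
  have : Fact (1 ≤ q) := ⟨ENNReal.HolderConjugate.one_le q p⟩
  have hpair : ∀ {c : X → H} (hc : MemLp c p μ),
      (innerSL ℝ).lpPairing μ q p (hF.toLp F) (hc.toLp c) = ∫ x, inner ℝ (F x) (c x) ∂μ := by
    intro c hc
    rw [ContinuousLinearMap.lpPairing_eq_integral]
    refine integral_congr_ae ?_
    filter_upwards [hF.coeFn_toLp, hc.coeFn_toLp] with x hFx hcx
    rw [hFx, hcx, innerSL_apply_apply]
  simpa only [hpair, Function.comp_def] using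
    (((innerSL ℝ).lpPairing μ q p (hF.toLp F)).continuous.tendsto _).comp
      ((Lp.tendsto_Lp_iff_tendsto_eLpNorm'' g hg G hG).2 hgG)

theorem tendsto_eLpNorm_smul_sub {X H ι : Type*} [MeasurableSpace X] [NormedAddCommGroup H]
    [NormedSpace ℝ H] {μ : Measure X} {p : ℝ≥0∞} (hp : 1 ≤ p) {l : Filter ι}
    {u : ι → X → ℝ} {U : X → ℝ} {g : ι → X → H} {G : X → H} (hu : ∀ n, AEStronglyMeasurable (u n) μ)
    (hU : MemLp U ⊤ μ) (hg : ∀ n, AEStronglyMeasurable (g n) μ) (hG : MemLp G p μ)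
    (huU : Tendsto (fun n => eLpNorm (u n - U) ⊤ μ) l (𝓝 0))
    (hgG : Tendsto (fun n => eLpNorm (g n - G) p μ) l (𝓝 0)) :
    Tendsto (fun n => eLpNorm (u n • g n - U • G) p μ) l (𝓝 0) := by
  have hexpand : ∀ n, u n • g n - U • G =
      (u n - U) • (g n - G) + (u n - U) • G + U • (g n - G) := fun n => by
    simp only [sub_smul, smul_sub]
    abel
  have hbound : ∀ n, eLpNorm (u n • g n - U • G) p μ ≤
      eLpNorm (u n - U) ⊤ μ * eLpNorm (g n - G) p μ + eLpNorm (u n - U) ⊤ μ * eLpNorm G p μ +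
        eLpNorm U ⊤ μ * eLpNorm (g n - G) p μ := by
    intro n
    have hu' : AEStronglyMeasurable (u n - U) μ := (hu n).sub hU.1
    have hg' : AEStronglyMeasurable (g n - G) μ := (hg n).sub hG.1
    rw [hexpand]
    refine (eLpNorm_add_le ((hu'.smul hg').add (hu'.smul hG.1)) (hU.1.smul hg') hp).trans ?_
    refine add_le_add ((eLpNorm_add_le (hu'.smul hg') (hu'.smul hG.1) hp).trans
      (add_le_add ?_ ?_)) ?_
    · exact eLpNorm_smul_le_mul_eLpNorm hg' hu'
    · exact eLpNorm_smul_le_mul_eLpNorm hG.1 hu'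
    · exact eLpNorm_smul_le_mul_eLpNorm hg' hU.1
  refine tendsto_of_tendsto_of_tendsto_of_le_of_le tendsto_const_nhds ?_ (fun _ => zero_le) hbound
  simpa using ((ENNReal.Tendsto.mul huU (.inr ENNReal.zero_ne_top) hgG
    (.inr ENNReal.zero_ne_top)).add (ENNReal.Tendsto.mul_const huU (.inr hG.2.ne))).add
    (ENNReal.Tendsto.const_mul hgG (.inr hU.2.ne))

/-- Test functions `φ n` on `Ω` converging uniformly to `w` with gradients converging to `G` in
`L^p`: the way an element of `W^1_p` with zero boundary values is approximated when `p > 2`. -/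
structure TestApproximation (Ω : Set Plane) (p : ℝ≥0∞) (φ : ℕ → Plane → ℝ) (w : Plane → ℝ)
    (G : Plane → Plane) : Prop where
  isTestFunction : ∀ n, IsTestFunction Ω (φ n)
  tendstoUniformly : TendstoUniformly φ w atTop
  memLp : MemLp G p (volume.restrict Ω)
  tendsto_gradient :
    Tendsto (fun n => eLpNorm (gradient (φ n) - G) p (volume.restrict Ω)) atTop (𝓝 0)

namespace TestApproximation

variable {Ω : Set Plane} {p : ℝ≥0∞} {φ : ℕ → Plane → ℝ} {w : Plane → ℝ} {G : Plane → Plane}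

theorem continuous (h : TestApproximation Ω p φ w G) : Continuous w :=
  h.tendstoUniformly.continuous (.of_forall fun n => (h.isTestFunction n).continuous)

theorem eq_zero_of_notMem (h : TestApproximation Ω p φ w G) {x : Plane} (hx : x ∉ Ω) :
    w x = 0 := by
  have hzero : ∀ n, φ n x = 0 := fun n =>
    image_eq_zero_of_notMem_tsupport fun hmem => hx ((h.isTestFunction n).tsupport_subset hmem)
  exact tendsto_nhds_unique (h.tendstoUniformly.tendsto_at x) (by simp [hzero])

theorem tendsto_eLpNorm_top (h : TestApproximation Ω p φ w G) :
    Tendsto (fun n => eLpNorm (φ n - w) ⊤ (volume.restrict Ω)) atTop (𝓝 0) :=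
  tendsto_eLpNorm_top_of_tendstoUniformly _ h.tendstoUniformly

theorem memLp_top (h : TestApproximation Ω p φ w G) : MemLp w ⊤ (volume.restrict Ω) := by
  obtain ⟨n, hn⟩ := (h.tendsto_eLpNorm_top.eventually_lt_const ENNReal.zero_lt_top).exists
  have hdiff : MemLp (φ n - w) ⊤ (volume.restrict Ω) :=
    ⟨((h.isTestFunction n).continuous.sub h.continuous).aestronglyMeasurable, hn⟩
  simpa using ((h.isTestFunction n).memLp ⊤).sub hdiff

theorem integrableOn_inner_smul (h : TestApproximation Ω p φ w G) {F : Plane → Plane} {q : ℝ≥0∞}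
    [ENNReal.HolderConjugate q p] (hF : MemLp F q (volume.restrict Ω)) :
    IntegrableOn (fun x => inner ℝ (F x) (w x • G x)) Ω :=
  memLp_one_iff_integrable.1
    ((innerSL ℝ).memLp_of_bilin (p := q) (q := p) 1 hF (h.memLp.smul h.memLp_top))

theorem integral_inner_smul (h : TestApproximation Ω p φ w G) {F : Plane → Plane} {q : ℝ≥0∞}
    [ENNReal.HolderConjugate q p] (hF : MemLp F q (volume.restrict Ω)) {c : ℝ} {a : Plane}
    (hdiv : HasDistribDivergence Ω F fun φ => c * φ a) :
    ∫ x in Ω, inner ℝ (F x) (w x • G x) = -(c / 2) * w a ^ 2 := by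
  have hprod : Tendsto (fun n => eLpNorm (φ n • gradient (φ n) - w • G) p (volume.restrict Ω))
      atTop (𝓝 0) :=
    tendsto_eLpNorm_smul_sub (ENNReal.HolderConjugate.one_le p q)
      (fun n => ((h.isTestFunction n).memLp ⊤).1) h.memLp_top
      (fun n => ((h.isTestFunction n).memLp_gradient p).1) h.memLp h.tendsto_eLpNorm_top
      h.tendsto_gradient
  have hlim := tendsto_integral_inner hF (fun n =>
    ((h.isTestFunction n).memLp_gradient p).smul ((h.isTestFunction n).memLp ⊤))
    (h.memLp.smul h.memLp_top) hprod
  refine tendsto_nhds_unique hlim ?_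
  convert ((h.tendstoUniformly.tendsto_at a).pow 2).const_mul (-(c / 2)) using 2 with n
  refine (hdiv.integral_inner_smul_gradient (h.isTestFunction n)).trans ?_
  rw [Pi.mul_apply]
  ring

end TestApproximation

theorem MemW1pZero.exists_testApproximation {Ω : Set Plane} (hvol : volume Ω ≠ ⊤) {p : ℝ≥0∞}
    (hp : 2 < p) {v : Plane → ℝ} (hv : MemW1pZero Ω p v) :
    ∃ G w φ, HasWeakGradient Ω v G ∧ v =ᵐ[volume.restrict Ω] w ∧ TestApproximation Ω p φ w G := by
  obtain ⟨G, hG, hvp, hGp, happrox⟩ := hv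
  obtain ⟨C, hsob⟩ := exists_enorm_le_eLpNorm_gradient hvol hp
  set μ := volume.restrict Ω
  have hε : ∀ n : ℕ, 0 < (n : ℝ≥0∞)⁻¹ := fun n => by simp
  choose φ hφ hφv hφG using fun n : ℕ => happrox (n : ℝ≥0∞)⁻¹ (hε n)
  have hlim : ∀ {f : ℕ → ℝ≥0∞}, (∀ n, f n ≤ (n : ℝ≥0∞)⁻¹) → Tendsto f atTop (𝓝 0) := fun hf =>
    tendsto_of_tendsto_of_tendsto_of_le_of_le tendsto_const_nhds ENNReal.tendsto_inv_nat_nhds_zero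
      (fun _ => zero_le) hf
  have hgrad : Tendsto (fun n => eLpNorm (gradient (φ n) - G) p μ) atTop (𝓝 0) :=
    hlim fun n => (eLpNorm_sub_comm _ _ _ _).trans_le (hφG n)
  have hcauchy : ∀ m n y, edist (φ m y) (φ n y) ≤
      C * (eLpNorm (gradient (φ m) - G) p μ + eLpNorm (gradient (φ n) - G) p μ) := by
    intro m n y
    calc edist (φ m y) (φ n y) = ‖(φ m - φ n) y‖ₑ := edist_eq_enorm_sub _ _
      _ ≤ C * eLpNorm (gradient (φ m - φ n)) p μ := hsob _ ((hφ m).sub (hφ n)) y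
      _ = C * eLpNorm ((gradient (φ m) - G) - (gradient (φ n) - G)) p μ := by
          rw [(hφ m).gradient_sub (hφ n), sub_sub_sub_cancel_right]
      _ ≤ C * (eLpNorm (gradient (φ m) - G) p μ + eLpNorm (gradient (φ n) - G) p μ) := by
          gcongr
          exact eLpNorm_sub_le (((hφ m).memLp_gradient p).1.sub hGp.1)
            (((hφ n).memLp_gradient p).1.sub hGp.1) (one_le_two.trans hp.le)
  obtain ⟨w, hw⟩ := exists_tendstoUniformly_of_edist_le hgrad hcauchy
  have happ : TestApproximation Ω p φ w G := ⟨hφ, hw, hGp, hgrad⟩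
  have hmeas : ∀ n, AEStronglyMeasurable (φ n) μ := fun n => (hφ n).continuous.aestronglyMeasurable
  have hφ_v : TendstoInMeasure μ φ atTop v :=
    tendstoInMeasure_of_tendsto_eLpNorm (zero_lt_two.trans hp).ne' hmeas hvp.1
      (hlim fun n => (eLpNorm_sub_comm _ _ _ _).trans_le (hφv n))
  have hφ_w : TendstoInMeasure μ φ atTop w :=
    tendstoInMeasure_of_tendsto_eLpNorm_top happ.tendsto_eLpNorm_top
  exact ⟨G, w, φ, hG, tendstoInMeasure_ae_unique hφ_v hφ_w, happ⟩

theorem MemWeakL2.memLp_conjExponent {Ω : Set Plane} (hvol : volume Ω ≠ ⊤) {b : Plane → Plane}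
    (hb : MemWeakL2 Ω b) {p : ℝ≥0∞} (hp : 2 < p) :
    MemLp b p.conjExponent (volume.restrict Ω) := by
  have hconj : ENNReal.HolderConjugate p.conjExponent p :=
    (ENNReal.HolderConjugate.conjExponent (one_le_two.trans hp.le)).symm
  exact hb.memLp hvol (ENNReal.HolderConjugate.ne_zero _ p) (lt_two_of_holderConjugate hp)

theorem memLp_totalDrift {Ω : Set Plane} (hvol : volume Ω ≠ ⊤) {b : Plane → Plane} {q : ℝ≥0∞}
    (hb : MemLp b q (volume.restrict Ω)) (hq0 : q ≠ 0) (hq2 : q < 2) (α : ℝ) :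
    MemLp (totalDrift b α) q (volume.restrict Ω) := by
  obtain ⟨C, hC⟩ := exists_eLpNorm_radialField_sub_le hvol hq0 hq2
  have hradial : MemLp radialField q (volume.restrict Ω) :=
    ⟨measurable_radialField.aestronglyMeasurable, by
      simpa using (hC 0).trans_lt ENNReal.coe_lt_top⟩
  rw [totalDrift_eq]
  exact hb.sub (hradial.const_smul α)

theorem mainTheorem3_general {Ω : Set Plane} (hΩ : IsOpen Ω) (hvol : volume Ω ≠ ⊤)
    {b : Plane → Plane} (hdiv : HasDistribDivergence Ω b fun _ => 0) (α : ℝ) :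
    HasDistribDivergence Ω (totalDrift b α) (fun φ => -(2 * Real.pi * α) * φ 0) ∧
    ∀ p : ℝ≥0∞, 2 < p → MemLp b p.conjExponent (volume.restrict Ω) →
      ∀ v : Plane → ℝ, MemW1pZero Ω p v →
        ∃ w : Plane → ℝ, Continuous w ∧ (∀ x ∉ Ω, w x = 0) ∧ v =ᵐ[volume.restrict Ω] w ∧
          ∀ Dv : Plane → Plane, HasWeakGradient Ω v Dv →
            IntegrableOn (driftIntegrand b α Dv v) Ω ∧
            driftForm Ω b α Dv v = Real.pi * α * |w 0| ^ 2 := by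
  have hdivα := hasDistribDivergence_totalDrift hΩ.measurableSet hdiv α
  refine ⟨hdivα, fun p hp hb v hv => ?_⟩
  have hconj : ENNReal.HolderConjugate p.conjExponent p :=
    (ENNReal.HolderConjugate.conjExponent (one_le_two.trans hp.le)).symm
  obtain ⟨G, w, φ, hG, hvw, happ⟩ := hv.exists_testApproximation hvol hp
  have hbα := memLp_totalDrift hvol hb (ENNReal.HolderConjugate.ne_zero _ p)
    (lt_two_of_holderConjugate hp) α
  refine ⟨w, happ.continuous, fun x => happ.eq_zero_of_notMem, hvw, fun Dv hDv => ?_⟩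
  have hae : driftIntegrand b α Dv v =ᵐ[volume.restrict Ω]
      fun x => inner ℝ (totalDrift b α x) (w x • G x) := by
    filter_upwards [hvw, hDv.ae_eq hΩ hG] with x hvx hDx
    rw [driftIntegrand, hvx, hDx, real_inner_smul_right, mul_comm]
  refine ⟨(happ.integrableOn_inner_smul hbα).congr hae.symm, ?_⟩
  rw [driftForm, integral_congr_ae hae, happ.integral_inner_smul hbα hdivα, sq_abs]
  ring

theorem mainTheorem3 (Ω : Set Plane) (hΩ : IsOpen Ω) (hΩb : Bornology.IsBounded Ω)
    (h0 : (0 : Plane) ∈ Ω) (b : Plane → Plane) (hb : MemWeakL2 Ω b)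
    (hdiv : HasDistribDivergence Ω b (fun _ => 0)) (α : ℝ) :
    HasDistribDivergence Ω (totalDrift b α) (fun φ => -(2 * Real.pi * α) * φ 0) ∧
    ∀ p : ℝ≥0∞, 2 < p → ∀ v : Plane → ℝ, MemW1pZero Ω p v →
      -- `w` is the continuous representative of `v`
      ∃ w : Plane → ℝ, ContinuousOn w (closure Ω) ∧ v =ᵐ[volume.restrict Ω] w ∧
        ∀ Dv : Plane → Plane, HasWeakGradient Ω v Dv →
          IntegrableOn (driftIntegrand b α Dv v) Ω ∧
          driftForm Ω b α Dv v = Real.pi * α * |w 0| ^ 2 := by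
  refine (mainTheorem3_general hΩ hΩb.measure_lt_top.ne hdiv α).imp_right fun hform p hp v hv => ?_
  obtain ⟨w, hw, -, hw'⟩ := hform p hp (hb.memLp_conjExponent hΩb.measure_lt_top.ne hp) v hv
  exact ⟨w, hw.continuousOn, hw'⟩
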